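/- Let $n\ge 2$ and let $SD_{8n}=\langle x,y : x^{4n}=y^2=1,\ yxy=x^{2n-1}\rangle$ be the semidihedral group. For a finite group $G$, the CCC-graph (commuting conjugacy class graph) $\Gamma_G$ is the simple graph whose vertices are the conjugacy classes of the non-central elements of $G$, two distinct classes being adjacent if some element of one commutes with some element of the other. For a finite simple graph $\mathcal G$ let $CN(\mathcal G)$ be the matrix with zero diagonal whose $(i,j)$ entry, $i\ne j$, is the number of vertices adjacent to both $v_i$ and $v_j$; let $CNRS(\mathcal G)$ be the diagonal matrix of the row sums of $CN(\mathcal G)$; let $CNL=CNRS-CN$ and $CNSL=CNRS+CN$. The CNL-spectrum and CNSL-spectrum of $\mathcal G$ are the multisets of eigenvalues of $CNL(\mathcal G)$ and $CNSL(\mathcal G)$, where $(\alpha)^a$ means that $\alpha$ is listed $a$ times (if the same value is listed more than once, its multiplicities add up). With $\Delta(\mathcal G)=\operatorname{tr}(CNRS(\mathcal G))/|V(\mathcal G)|$, the CNL-energy $LE_{CN}(\mathcal G)$ and the CNSL-energy $LE^+_{CN}(\mathcal G)$ are the sums of $|\alpha-\Delta(\mathcal G)|$ over the eigenvalues $\alpha$,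 counted with multiplicity, of $CNL(\mathcal G)$ and $CNSL(\mathcal G)$, respectively. Write $\Gamma=\Gamma_{SD_{8n}}$. (a) If $n$ is even, then (i) the CNL-spectrum of $\Gamma$ is $\{(0)^3,\ ((2n-1)(2n-3))^{2n-2}\}$ and $$LE_{CN}(\Gamma)=\frac{12(n-1)(4(n-2)n+3)}{2n+1};$$ (ii) the CNSL-spectrum of $\Gamma$ is $\{(0)^2,\ (2(2n-2)(2n-3))^1,\ ((2n-3)^2)^{2n-2}\}$ and $$LE^+_{CN}(\Gamma)=\begin{cases}\frac{28}{5}, & n=2,\\[2pt] \frac{8(n-1)(2n-3)(2n-1)}{2n+1}, & n\ge 4.\end{cases}$$ (b) If $n$ is odd, then (i) the CNL-spectrum of $\Gamma$ is $\{(0)^2,\ (8)^3,\ ((2n-2)(2n-4))^{2n-3}\}$ and $$LE_{CN}(\Gamma)=\begin{cases}24, & n=3,\\[2pt] \frac{4(2n-3)(5(n-3)n+4)}{n+1}, & n\ge 5;\end{cases}$$ (ii) the CNSL-spectrum of $\Gamma$ is $\{(2(2n-3)(2n-4))^1,\ ((2n-4)^2)^{2n-3},\ (12)^1,\ (4)^3\}$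 and $$LE^+_{CN}(\Gamma)=\begin{cases}24, & n=3,\\[2pt] \frac{16(n-3)(n-1)(2n-1)}{n+1}, & n\ge 5.\end{cases}$$ -/

import Mathlib

section CommonNeighborhood

/-- The common neighborhood matrix `CN(Γ)`: the `(i, j)` entry for `i ≠ j` is the number of
vertices adjacent to both `i` and `j`, and the diagonal is zero. -/
noncomputable def cnMatrix {V : Type*} [DecidableEq V] (Γ : SimpleGraph V) : Matrix V V ℝ :=
  Matrix.of fun i j => if i = j then 0 else ((Γ.commonNeighbors i j).ncard : ℝ)

/-- The diagonal matrix of row sums of `CN(Γ)`. -/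
noncomputable def cnrsMatrix {V : Type*} [Fintype V] [DecidableEq V] (Γ : SimpleGraph V) :
    Matrix V V ℝ :=
  Matrix.diagonal fun i => ∑ k, cnMatrix Γ i k

/-- The common neighborhood Laplacian matrix. -/
noncomputable def cnlMatrix {V : Type*} [Fintype V] [DecidableEq V] (Γ : SimpleGraph V) :
    Matrix V V ℝ :=
  cnrsMatrix Γ - cnMatrix Γ

/-- The common neighborhood signless Laplacian matrix. -/
noncomputable def cnslMatrix {V : Type*} [Fintype V] [DecidableEq V] (Γ : SimpleGraph V) :
    Matrix V V ℝ :=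
  cnrsMatrix Γ + cnMatrix Γ

/-- The CNL-spectrum: the multiset of eigenvalues of the CNL-matrix, with multiplicities. -/
noncomputable def cnlSpec {V : Type*} [Fintype V] [DecidableEq V] (Γ : SimpleGraph V) :
    Multiset ℝ :=
  (cnlMatrix Γ).charpoly.roots

/-- The CNSL-spectrum: the multiset of eigenvalues of the CNSL-matrix, with multiplicities. -/
noncomputable def cnslSpec {V : Type*} [Fintype V] [DecidableEq V] (Γ : SimpleGraph V) :
    Multiset ℝ :=
  (cnslMatrix Γ).charpoly.roots

/-- `Δ(Γ) = tr(CNRS(Γ)) / |V(Γ)|`. -/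
noncomputable def cnDelta {V : Type*} [Fintype V] [DecidableEq V] (Γ : SimpleGraph V) : ℝ :=
  (cnrsMatrix Γ).trace / (Fintype.card V : ℝ)

/-- The CNL-energy `LE_CN(Γ)`. -/
noncomputable def cnlEnergy {V : Type*} [Fintype V] [DecidableEq V] (Γ : SimpleGraph V) : ℝ :=
  ((cnlSpec Γ).map fun a => |a - cnDelta Γ|).sum

/-- The CNSL-energy `LE⁺_CN(Γ)`. -/
noncomputable def cnslEnergy {V : Type*} [Fintype V] [DecidableEq V] (Γ : SimpleGraph V) : ℝ :=
  ((cnslSpec Γ).map fun b => |b - cnDelta Γ|).sum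

end CommonNeighborhood

section CCCGraph

/-- The conjugacy classes of the non-central elements of `G`. -/
def CCCVertex (G : Type*) [Group G] : Type _ :=
  {c : ConjClasses G // ∃ x : G, x ∉ Subgroup.center G ∧ ConjClasses.mk x = c}

noncomputable instance CCCVertex.instDecidableEq (G : Type*) [Group G] :
    DecidableEq (CCCVertex G) :=
  Classical.decEq _

noncomputable instance CCCVertex.instFintype (G : Type*) [Group G] [Finite G] :
    Fintype (CCCVertex G) :=
  haveI : Finite (ConjClasses G) := Finite.of_surjective _ ConjClasses.mk_surjective
  haveI : Finite (CCCVertex G) := Subtype.finite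
  Fintype.ofFinite _

/-- The commuting conjugacy class graph: two distinct classes of non-central elements are
adjacent when some element of one commutes with some element of the other. -/
def cccGraph (G : Type*) [Group G] : SimpleGraph (CCCVertex G) where
  Adj c d := c ≠ d ∧
    ∃ x y : G, ConjClasses.mk x = c.1 ∧ ConjClasses.mk y = d.1 ∧ x * y = y * x
  symm := ⟨fun _ _ h => ⟨h.1.symm, by
    obtain ⟨x, y, hx, hy, hxy⟩ := h.2
    exact ⟨y, x, hy, hx, hxy.symm⟩⟩⟩
  loopless := ⟨fun _ h => h.1 rfl⟩

end CCCGraph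

section Semidihedral

/-- The relators of `⟨x, y : x^(4n) = y^2 = 1, yxy = x^(2n-1)⟩`, where `x`, `y` are the free
generators with index `0`, `1`. -/
def semidihedralRels (n : ℕ) : Set (FreeGroup (Fin 2)) :=
  {FreeGroup.of 0 ^ (4 * n),
   FreeGroup.of 1 ^ 2,
   FreeGroup.of 1 * FreeGroup.of 0 * FreeGroup.of 1 * (FreeGroup.of 0 ^ (2 * n - 1))⁻¹}

/-- The semidihedral group `SD_{8n} = ⟨x, y : x^(4n) = y^2 = 1, yxy = x^(2n-1)⟩` (for `n ≥ 2`). -/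
abbrev SD (n : ℕ) : Type :=
  PresentedGroup (semidihedralRels n)

/-- The presented group is finite: each element is a power of `x` times a power of `y`. -/
instance SD.instFinite (n : ℕ) : Finite (SD n) := by
  set x : SD n := PresentedGroup.of 0 with hx
  set y : SD n := PresentedGroup.of 1 with hy
  have h1 : x ^ (4 * n) = 1 := by
    have := PresentedGroup.one_of_mem (rels := semidihedralRels n)
      (x := FreeGroup.of 0 ^ (4 * n)) (by simp [semidihedralRels])
    exact this
  have h2 : y ^ 2 = 1 := by
    have := PresentedGroup.one_of_mem (rels := semidihedralRels n)
      (x := FreeGroup.of 1 ^ 2) (by simp [semidihedralRels])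
    exact this
  have h3 : y * x * y = x ^ (2 * n - 1) := by
    have := PresentedGroup.one_of_mem (rels := semidihedralRels n)
      (x := FreeGroup.of 1 * FreeGroup.of 0 * FreeGroup.of 1 * (FreeGroup.of 0 ^ (2 * n - 1))⁻¹)
      (by simp [semidihedralRels])
    exact mul_inv_eq_one.mp this
  have hyinv : y⁻¹ = y := inv_eq_of_mul_eq_one_left (by rw [← pow_two, h2])
  have hxfin : IsOfFinOrder x := by
    rw [isOfFinOrder_iff_pow_eq_one]
    rcases Nat.eq_zero_or_pos n with rfl | hn
    · refine ⟨1, one_pos, ?_⟩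
      have h : x = y⁻¹ * (y * x * y) * y⁻¹ := by group
      rw [h, h3, hyinv]
      simp [← pow_two, h2]
    · exact ⟨4 * n, by omega, h1⟩
  have hyfin : IsOfFinOrder y := isOfFinOrder_iff_pow_eq_one.mpr ⟨2, two_pos, h2⟩
  have : Finite (Subgroup.zpowers x) := finite_zpowers.mpr hxfin
  have : Finite (Subgroup.zpowers y) := finite_zpowers.mpr hyfin
  have hconj : ∀ i : ℤ, y * x ^ i = (x ^ (2 * n - 1)) ^ i * y := by
    intro i
    have h : (y * x * y⁻¹) ^ i = y * x ^ i * y⁻¹ := conj_zpow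
    rw [hyinv, h3] at h
    rw [h, mul_assoc, ← pow_two, h2, mul_one]
  refine Finite.of_surjective
    (fun p : Subgroup.zpowers x × Subgroup.zpowers y => (p.1 : SD n) * (p.2 : SD n)) ?_
  intro g
  have key : ∃ i j : ℤ, g = x ^ i * y ^ j := by
    have hg : g ∈ Subgroup.closure (Set.range (PresentedGroup.of (rels := semidihedralRels n))) := by
      rw [PresentedGroup.closure_range_of]; trivial
    have hyleft : ∀ i j : ℤ, ∃ i' j' : ℤ, y * (x ^ i * y ^ j) = x ^ i' * y ^ j' := by
      intro i j
      refine ⟨((2 * n - 1 : ℕ) : ℤ) * i, 1 + j, ?_⟩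
      rw [← mul_assoc, hconj, zpow_mul, zpow_natCast, zpow_add, zpow_one, mul_assoc]
    induction hg using Subgroup.closure_induction_left with
    | one => exact ⟨0, 0, by simp⟩
    | mul_left a ha b _ ih =>
      obtain ⟨i, j, rfl⟩ := ih
      obtain ⟨k, rfl⟩ := ha
      fin_cases k
      · exact ⟨1 + i, j, by rw [zpow_add, zpow_one, mul_assoc]; rfl⟩
      · exact hyleft i j
    | inv_mul_cancel a ha b _ ih =>
      obtain ⟨i, j, rfl⟩ := ih
      obtain ⟨k, rfl⟩ := ha
      fin_cases k
      · exact ⟨-1 + i, j, by rw [zpow_add, zpow_neg_one, mul_assoc]; rfl⟩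
      · change ∃ i' j' : ℤ, y⁻¹ * (x ^ i * y ^ j) = x ^ i' * y ^ j'
        rw [hyinv]
        exact hyleft i j
  obtain ⟨i, j, rfl⟩ := key
  exact ⟨(⟨x ^ i, i, rfl⟩, ⟨y ^ j, j, rfl⟩), rfl⟩

end Semidihedral

/-!
Let `G` be a finite nonabelian group with an abelian subgroup `A` of index two, let `t ∉ A`, and
let `φ` be the endomorphism `a ↦ t * a * t⁻¹ * a⁻¹` of `A`. Two elements `a * t` and `b * t` are
conjugate exactly when `a / b` lies in the range of `φ`, and they commute exactly when `a / b` lies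
in its kernel; an element of `A` commuting with some `a * t` is central. Hence the commuting
conjugacy class graph of `G` is a disjoint union of cliques: one formed by the classes inside `A`,
and one for each coset of `ker φ * range φ` in `A`. If `A` is cyclic, then `φ` is a power
map and the orders of the cliques are expressed by greatest common divisors; for the semidihedral
group they are `2 * n - 1, 1, 1` for even `n` and `2 * n - 2, 4` for odd `n`.

A clique of order `m` contributes to the common neighborhood Laplacian (respectively signless
Laplacian) a scalar matrix plus a constant one, with eigenvalues `0` and `m * (m - 2)`
(respectively `2 * (m - 1) * (m - 2)` and `(m - 2) ^ 2`), the second of multiplicity `m - 1`.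
The energies follow by comparing each eigenvalue with `Δ`.
-/

section Fibers

open Polynomial

variable {V κ ι R : Type*} [DecidableEq κ]

/-- The block matrix attached to the partition of `V` into the fibers of `f`: the block of the
fiber over `c` is constantly `b c`, and the entries outside the diagonal blocks vanish. -/
def fiberMatrix [Zero R] (f : V → κ) (b : κ → R) : Matrix V V R :=
  Matrix.of fun u v => if f u = f v then b (f u) else 0

theorem sum_fiberMatrix [Fintype V] [AddCommMonoid R] (f : V → κ) (b : κ → R) (u : V) :
    ∑ v, fiberMatrix f b u v = (f ⁻¹' {f u}).ncard • b (f u) := by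
  simp only [fiberMatrix, Matrix.of_apply]
  rw [← Finset.sum_filter, Finset.sum_const, ← Set.ncard_coe_finset]
  congr 3
  ext v
  simp [eq_comm]

theorem charpoly_scalar_add_const [Fintype ι] [DecidableEq ι] [Nonempty ι] [CommRing R]
    [Nontrivial R] (p b : R) :
    (Matrix.scalar ι p + Matrix.of fun _ _ => b).charpoly =
      (X - C p) ^ (Fintype.card ι - 1) * (X - C (p + Fintype.card ι * b)) := by
  have rank_one : (Matrix.scalar ι p + Matrix.of fun _ _ => b) =
      Matrix.vecMulVec (fun _ => b) (fun _ => 1) - Matrix.scalar ι (-p) := by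
    rw [map_neg, sub_neg_eq_add, add_comm]
    ext i j
    simp [Matrix.vecMulVec_apply]
  obtain ⟨k, hk⟩ : ∃ k, Fintype.card ι = k + 1 :=
    Nat.exists_eq_succ_of_ne_zero Fintype.card_ne_zero
  rw [rank_one, Matrix.charpoly_sub_scalar, Matrix.charpoly_vecMulVec, hk]
  simp only [dotProduct, mul_one, Finset.sum_const, Finset.card_univ, hk, nsmul_eq_mul,
    smul_eq_C_mul, map_neg, map_add, map_mul, map_natCast, sub_comp, mul_comp, pow_comp, X_comp,
    C_comp, natCast_comp, Nat.add_sub_cancel]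
  ring

variable [Fintype V] [DecidableEq V]

theorem charpoly_diagonal_add_fiberMatrix [Fintype κ] [CommRing R] [Nontrivial R] {f : V → κ}
    (hf : f.Surjective) (p b : κ → R) :
    (Matrix.diagonal (p ∘ f) + fiberMatrix f b).charpoly =
      ∏ c, (X - C (p c)) ^ ((f ⁻¹' {c}).ncard - 1) *
        (X - C (p c + (f ⁻¹' {c}).ncard * b c)) := by
  let e := Fintype.equivFin κ
  set M := Matrix.diagonal (p ∘ f) + fiberMatrix f b with hM
  have block_triangular : M.BlockTriangular fun v => e (f v) := by
    intro u v huv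
    have hfuv : f u ≠ f v := fun h => huv.ne (congrArg e h.symm)
    rw [hM, Matrix.add_apply, Matrix.diagonal_apply_ne _ fun h => hfuv (congrArg f h), fiberMatrix,
      Matrix.of_apply, if_neg hfuv, add_zero]
  rw [Matrix.charpoly, block_triangular.charmatrix.det_fintype, ← Equiv.prod_comp e]
  refine Finset.prod_congr rfl fun c _ => ?_
  have block_eq : M.toSquareBlock (fun v => e (f v)) (e c) =
      Matrix.scalar _ (p c) + Matrix.of fun _ _ => b c := by
    ext u v
    have hu : f u = c := e.injective u.2
    have hv : f v = c := e.injective v.2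
    simp [hM, fiberMatrix, Matrix.toSquareBlock_def, Matrix.diagonal_apply, hu, hv, Subtype.ext_iff]
  have card_block : Fintype.card {v // e (f v) = e c} = (f ⁻¹' {c}).ncard := by
    simp only [e.injective.eq_iff, ← Nat.card_eq_fintype_card, ← Nat.card_coe_set_eq]
    rfl
  have : Nonempty {v // e (f v) = e c} :=
    let ⟨v, hv⟩ := hf c
    ⟨⟨v, congrArg e hv⟩⟩
  rw [← Matrix.charmatrix_toSquareBlock, ← Matrix.charpoly, block_eq, charpoly_scalar_add_const,
    card_block]

theorem roots_charpoly_diagonal_add_fiberMatrix [Fintype κ] [CommRing R] [IsDomain R] {f : V → κ}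
    (hf : f.Surjective) (p b : κ → R) :
    (Matrix.diagonal (p ∘ f) + fiberMatrix f b).charpoly.roots =
      ∑ c, (Multiset.replicate ((f ⁻¹' {c}).ncard - 1) (p c) +
        {p c + (f ⁻¹' {c}).ncard * b c}) := by
  have factor_ne_zero (c : κ) : (X - C (p c)) ^ ((f ⁻¹' {c}).ncard - 1) *
      (X - C (p c + (f ⁻¹' {c}).ncard * b c)) ≠ 0 :=
    mul_ne_zero (pow_ne_zero _ (X_sub_C_ne_zero _)) (X_sub_C_ne_zero _)
  rw [charpoly_diagonal_add_fiberMatrix hf,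
    roots_prod _ _ (Finset.prod_ne_zero_iff.2 fun c _ => factor_ne_zero c)]
  refine Multiset.bind_congr fun c _ => ?_
  rw [roots_mul (factor_ne_zero c), roots_pow, roots_X_sub_C, roots_X_sub_C,
    Multiset.nsmul_singleton]

end Fibers

section CliqueUnion

universe u

variable {V : Type u} {κ : Type*} [DecidableEq V] {Γ : SimpleGraph V} {f : V → κ}

theorem cnMatrix_eq_fiberMatrix_sub_diagonal [Finite V] [DecidableEq κ]
    (hΓ : ∀ u v, Γ.Adj u v ↔ u ≠ v ∧ f u = f v) :
    cnMatrix Γ = fiberMatrix f (fun c => ((f ⁻¹' {c}).ncard : ℝ) - 2) -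
      Matrix.diagonal ((fun c => ((f ⁻¹' {c}).ncard : ℝ) - 2) ∘ f) := by
  ext u v
  obtain rfl | huv := eq_or_ne u v
  · simp [cnMatrix, fiberMatrix]
  rw [cnMatrix, Matrix.of_apply, if_neg huv, Matrix.sub_apply, Matrix.diagonal_apply_ne _ huv,
    sub_zero, fiberMatrix, Matrix.of_apply]
  split_ifs with hfuv
  · have common_eq : Γ.commonNeighbors u v = f ⁻¹' {f u} \ {u, v} := by
      ext w
      simp only [SimpleGraph.mem_commonNeighbors, hΓ, Set.mem_sdiff, Set.mem_preimage,
        Set.mem_singleton_iff, Set.mem_insert_iff]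
      grind
    have pair_subset : {u, v} ⊆ f ⁻¹' {f u} := by
      simp [Set.insert_subset_iff, hfuv]
    rw [common_eq, Set.cast_ncard_sdiff pair_subset (Set.toFinite _), Set.ncard_pair huv,
      Nat.cast_ofNat]
  · have common_eq : Γ.commonNeighbors u v = ∅ := by
      ext w
      simp only [SimpleGraph.mem_commonNeighbors, hΓ, Set.mem_empty_iff_false, iff_false]
      exact fun h => hfuv (h.1.2.trans h.2.2.symm)
    rw [common_eq, Set.ncard_empty, Nat.cast_zero]

variable [Fintype V]

theorem cnrsMatrix_eq_diagonal (hΓ : ∀ u v, Γ.Adj u v ↔ u ≠ v ∧ f u = f v) :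
    cnrsMatrix Γ = Matrix.diagonal
      ((fun c => (((f ⁻¹' {c}).ncard : ℝ) - 1) * ((f ⁻¹' {c}).ncard - 2)) ∘ f) := by
  classical
  rw [cnrsMatrix, cnMatrix_eq_fiberMatrix_sub_diagonal hΓ]
  congr 1
  ext u
  simp only [Matrix.sub_apply, Finset.sum_sub_distrib, sum_fiberMatrix, Matrix.diagonal_apply,
    Finset.sum_ite_eq, Finset.mem_univ, if_true, Function.comp_apply, nsmul_eq_mul]
  ring

theorem cnlMatrix_eq_diagonal_add_fiberMatrix [DecidableEq κ]
    (hΓ : ∀ u v, Γ.Adj u v ↔ u ≠ v ∧ f u = f v) :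
    cnlMatrix Γ =
      Matrix.diagonal ((fun c => ((f ⁻¹' {c}).ncard : ℝ) * ((f ⁻¹' {c}).ncard - 2)) ∘ f) +
        fiberMatrix f (fun c => -(((f ⁻¹' {c}).ncard : ℝ) - 2)) := by
  rw [cnlMatrix, cnrsMatrix_eq_diagonal hΓ, cnMatrix_eq_fiberMatrix_sub_diagonal hΓ]
  ext u v
  simp only [Matrix.sub_apply, Matrix.add_apply, Matrix.diagonal_apply, fiberMatrix,
    Matrix.of_apply, Function.comp_apply]
  split_ifs <;> ring

theorem cnslMatrix_eq_diagonal_add_fiberMatrix [DecidableEq κ]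
    (hΓ : ∀ u v, Γ.Adj u v ↔ u ≠ v ∧ f u = f v) :
    cnslMatrix Γ =
      Matrix.diagonal ((fun c => (((f ⁻¹' {c}).ncard : ℝ) - 2) ^ 2) ∘ f) +
        fiberMatrix f (fun c => ((f ⁻¹' {c}).ncard : ℝ) - 2) := by
  rw [cnslMatrix, cnrsMatrix_eq_diagonal hΓ, cnMatrix_eq_fiberMatrix_sub_diagonal hΓ]
  ext u v
  simp only [Matrix.sub_apply, Matrix.add_apply, Matrix.diagonal_apply, fiberMatrix,
    Matrix.of_apply, Function.comp_apply]
  split_ifs <;> ring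

/-- `Γ` is the disjoint union of complete graphs whose orders form the multiset `s`: the cliques
are the (nonempty) fibers of a map `f`, and `u ≠ v` are adjacent exactly when they lie in the same
fiber. -/
def IsCliqueUnion {V : Type u} (Γ : SimpleGraph V) (s : Multiset ℕ) : Prop :=
  ∃ (κ : Type u) (_ : Fintype κ) (f : V → κ), f.Surjective ∧
    (∀ u v, Γ.Adj u v ↔ u ≠ v ∧ f u = f v) ∧
    Finset.univ.val.map (fun c => (f ⁻¹' {c}).ncard) = s

namespace IsCliqueUnion

variable {s : Multiset ℕ}

theorem cnlSpec_eq (hs : IsCliqueUnion Γ s) :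
    cnlSpec Γ = s.bind fun m => Multiset.replicate (m - 1) ((m : ℝ) * (m - 2)) + {0} := by
  classical
  obtain ⟨κ, _, f, hf, hΓ, rfl⟩ := hs
  rw [cnlSpec, cnlMatrix_eq_diagonal_add_fiberMatrix hΓ,
    roots_charpoly_diagonal_add_fiberMatrix hf, Multiset.bind_map]
  refine Multiset.bind_congr fun c _ => ?_
  rw [mul_neg, add_neg_cancel]

theorem cnslSpec_eq (hs : IsCliqueUnion Γ s) :
    cnslSpec Γ = s.bind fun m =>
      Multiset.replicate (m - 1) (((m : ℝ) - 2) ^ 2) + {2 * ((m : ℝ) - 1) * (m - 2)} := by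
  classical
  obtain ⟨κ, _, f, hf, hΓ, rfl⟩ := hs
  rw [cnslSpec, cnslMatrix_eq_diagonal_add_fiberMatrix hΓ,
    roots_charpoly_diagonal_add_fiberMatrix hf, Multiset.bind_map]
  refine Multiset.bind_congr fun c _ => ?_
  congr 2
  ring

theorem cnDelta_eq (hs : IsCliqueUnion Γ s) :
    cnDelta Γ = (s.map fun m : ℕ => (m : ℝ) * ((m - 1) * (m - 2))).sum / s.sum := by
  classical
  obtain ⟨κ, _, f, -, hΓ, rfl⟩ := hs
  have fiber_filter (c : κ) : (Finset.univ.filter fun v => f v = c).card = (f ⁻¹' {c}).ncard := by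
    rw [← Set.ncard_coe_finset]
    congr 1
    ext v
    simp
  rw [cnDelta, cnrsMatrix_eq_diagonal hΓ, Matrix.trace_diagonal, Multiset.map_map]
  congr 1
  · simp only [Function.comp_apply]
    rw [← Finset.sum_fiberwise' Finset.univ f fun c =>
      (((f ⁻¹' {c}).ncard : ℝ) - 1) * ((f ⁻¹' {c}).ncard - 2)]
    simp only [Finset.sum_const, fiber_filter, nsmul_eq_mul]
    rfl
  · rw [← Finset.card_univ, Finset.card_eq_sum_card_fiberwise fun v _ => Finset.mem_univ (f v)]
    simp only [fiber_filter]
    rfl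

end IsCliqueUnion

end CliqueUnion

section AbelianIndexTwo

open scoped IsMulCommutative

universe u

variable {G : Type u} [Group G] {A : Subgroup G} {t : G}

theorem exists_coe_eq_or_exists_coe_mul_eq (hA : A.index = 2) (ht : t ∉ A) (g : G) :
    (∃ a : A, a = g) ∨ ∃ a : A, a * t = g := by
  by_cases hg : g ∈ A
  · exact .inl ⟨⟨g, hg⟩, rfl⟩
  · have : g * t⁻¹ ∈ A := (Subgroup.mul_mem_iff_of_index_two hA).2 (by simp [hg, ht])
    exact .inr ⟨⟨_, this⟩, inv_mul_cancel_right g t⟩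

theorem coe_mul_notMem (ht : t ∉ A) (a : A) : (a * t : G) ∉ A := fun h =>
  ht ((A.mul_mem_cancel_left a.2).1 h)

theorem not_isConj_coe_coe_mul [A.Normal] (ht : t ∉ A) (a b : A) :
    ¬IsConj (a : G) (b * t) := fun h => by
  obtain ⟨g, hg⟩ := isConj_iff.1 h
  exact coe_mul_notMem ht b (hg ▸ Subgroup.Normal.conj_mem inferInstance _ a.2 g)

theorem commute_coe_coe [IsMulCommutative A] (a b : A) : Commute (a : G) b :=
  setLike_mul_comm a.2 b.2

/-- The homomorphism `a ↦ ⁅t, a⁆ = t * a * t⁻¹ * a⁻¹` from an abelian normal subgroup `A` to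
itself. Its kernel is the centralizer of `t` in `A`. -/
def commutatorHom (A : Subgroup G) [A.Normal] [IsMulCommutative A] (t : G) : A →* A :=
  (MulAut.conjNormal t).toMonoidHom / MonoidHom.id A

variable [A.Normal] [IsMulCommutative A]

theorem mul_coe_eq_commutatorHom_mul (a : A) : t * a = (commutatorHom A t a * a : A) * t := by
  simp [commutatorHom]

theorem mem_ker_commutatorHom_iff {a : A} : a ∈ (commutatorHom A t).ker ↔ Commute t a := by
  rw [MonoidHom.mem_ker, Commute, SemiconjBy, mul_coe_eq_commutatorHom_mul, mul_left_inj,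
    SetLike.coe_eq_coe, mul_eq_right]

theorem commute_coe_coe_mul_iff {a b : A} :
    Commute (a : G) (b * t) ↔ a ∈ (commutatorHom A t).ker := by
  rw [mem_ker_commutatorHom_iff]
  refine ⟨fun h => ?_, fun h => (commute_coe_coe a b).mul_right h.symm⟩
  simpa using ((commute_coe_coe a b).inv_right.mul_right h).symm

theorem commute_coe_mul_coe_mul_iff {a b : A} :
    Commute (a * t : G) (b * t) ↔ a / b ∈ (commutatorHom A t).ker := by
  have collect (c d : A) : (c * t * (d * t) : G) = (c * d * commutatorHom A t d : A) * t * t := by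
    rw [mul_assoc, ← mul_assoc t, mul_coe_eq_commutatorHom_mul, mul_comm (commutatorHom A t d)]
    simp only [Subgroup.coe_mul, mul_assoc]
  rw [Commute, SemiconjBy, collect, collect, mul_left_inj, mul_left_inj, SetLike.coe_eq_coe,
    mul_comm b, mul_right_inj, MonoidHom.mem_ker, map_div, div_eq_one, eq_comm]

theorem conj_coe_mul_eq (a d : A) :
    (d * (a * t) * (d : G)⁻¹) = (a / commutatorHom A t d : A) * t := by
  rw [mul_inv_eq_iff_eq_mul, mul_assoc, mul_coe_eq_commutatorHom_mul, ← mul_assoc, ← mul_assoc,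
    ← Subgroup.coe_mul, ← Subgroup.coe_mul, ← mul_assoc, div_mul_cancel, mul_comm]

section IndexTwo

variable (hA : A.index = 2) (ht : t ∉ A)
include hA ht

theorem coe_mem_center_iff {a : A} :
    (a : G) ∈ Subgroup.center G ↔ a ∈ (commutatorHom A t).ker := by
  rw [Subgroup.mem_center_iff, mem_ker_commutatorHom_iff]
  refine ⟨fun h => h t, fun h g => ?_⟩
  obtain ⟨b, rfl⟩ | ⟨b, rfl⟩ := exists_coe_eq_or_exists_coe_mul_eq hA ht g
  · exact commute_coe_coe b a
  · exact (commute_coe_coe_mul_iff.2 (mem_ker_commutatorHom_iff.2 h)).symm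

theorem isConj_coe_coe_iff {a b : A} :
    IsConj (a : G) b ↔ b = a ∨ b = commutatorHom A t a * a := by
  have conj_t : t * a * t⁻¹ = (commutatorHom A t a * a : A) := by
    rw [mul_coe_eq_commutatorHom_mul, mul_inv_cancel_right]
  rw [isConj_iff]
  constructor
  · rintro ⟨g, hg⟩
    obtain ⟨d, rfl⟩ | ⟨d, rfl⟩ := exists_coe_eq_or_exists_coe_mul_eq hA ht g
    · rw [(commute_coe_coe d a).mul_inv_cancel, SetLike.coe_eq_coe] at hg
      exact .inl hg.symm
    · rw [mul_inv_rev, mul_assoc (d : G), ← mul_assoc, mul_assoc (d : G), conj_t,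
        (commute_coe_coe d _).mul_inv_cancel, SetLike.coe_eq_coe] at hg
      exact .inr hg.symm
  · rintro (rfl | rfl)
    · exact ⟨1, by simp⟩
    · exact ⟨t, conj_t⟩

theorem isConj_coe_mul_coe_mul_iff {a b : A} :
    IsConj (a * t : G) (b * t) ↔ a / b ∈ (commutatorHom A t).range := by
  have conj_eq_iff (d : A) :
      (d * (a * t) * (d : G)⁻¹) = b * t ↔ commutatorHom A t d = a / b := by
    rw [conj_coe_mul_eq, mul_left_inj, SetLike.coe_eq_coe, div_eq_iff_eq_mul, eq_div_iff_mul_eq',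
      mul_comm b, eq_comm]
  rw [isConj_iff, MonoidHom.mem_range]
  constructor
  · rintro ⟨g, hg⟩
    -- `a * t` commutes with itself, so conjugating by elements of `A` suffices.
    obtain ⟨d, rfl⟩ | ⟨d, rfl⟩ :=
      exists_coe_eq_or_exists_coe_mul_eq hA (coe_mul_notMem ht a) g
    · exact ⟨d, (conj_eq_iff d).1 hg⟩
    · rw [mul_inv_rev, mul_assoc (d : G), ← mul_assoc, mul_assoc (d : G), mul_inv_cancel_right]
        at hg
      exact ⟨d, (conj_eq_iff d).1 hg⟩
  · rintro ⟨d, hd⟩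
    exact ⟨d, (conj_eq_iff d).2 hd⟩

end IndexTwo

theorem coe_mul_notMem_center (hφ : commutatorHom A t ≠ 1) (a : A) :
    (a * t : G) ∉ Subgroup.center G := fun h =>
  hφ <| MonoidHom.ext fun c =>
    commute_coe_coe_mul_iff.1 (Subgroup.mem_center_iff.1 h (c : G))

open Classical in
/-- The invariant separating the cliques of the commuting conjugacy class graph of `G`: all of `A`
gets `none`, and `a * t` gets the coset of `a` modulo the product of the kernel and the range of
`commutatorHom A t`. -/
noncomputable def cosetLabel (A : Subgroup G) [A.Normal] [IsMulCommutative A] (t g : G) :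
    Option (A ⧸ (commutatorHom A t).ker ⊔ (commutatorHom A t).range) :=
  if h : g * t⁻¹ ∈ A then some (⟨g * t⁻¹, h⟩ : A) else none

theorem cosetLabel_coe (ht : t ∉ A) (a : A) : cosetLabel A t a = none :=
  dif_neg fun h => ht (inv_mem_iff.1 ((A.mul_mem_cancel_left a.2).1 h))

theorem cosetLabel_coe_mul (a : A) : cosetLabel A t (a * t) = some ↑a := by
  simp [cosetLabel]

theorem cosetLabel_coe_mul_eq_iff {a b : A} :
    cosetLabel A t (a * t) = cosetLabel A t (b * t) ↔
      ∃ k ∈ (commutatorHom A t).ker, ∃ r ∈ (commutatorHom A t).range, k * r = a / b := by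
  rw [cosetLabel_coe_mul, cosetLabel_coe_mul, Option.some_inj, eq_comm, QuotientGroup.eq,
    inv_mul_eq_div, Subgroup.mem_sup]

section IndexTwo

variable (hA : A.index = 2) (ht : t ∉ A)
include hA ht

theorem cosetLabel_eq_of_isConj {g h : G} (hgh : IsConj g h) :
    cosetLabel A t g = cosetLabel A t h := by
  obtain ⟨a, rfl⟩ | ⟨a, rfl⟩ := exists_coe_eq_or_exists_coe_mul_eq hA ht g <;>
    obtain ⟨b, rfl⟩ | ⟨b, rfl⟩ := exists_coe_eq_or_exists_coe_mul_eq hA ht h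
  · rw [cosetLabel_coe ht, cosetLabel_coe ht]
  · exact absurd hgh (not_isConj_coe_coe_mul ht a b)
  · exact absurd hgh.symm (not_isConj_coe_coe_mul ht b a)
  · exact cosetLabel_coe_mul_eq_iff.2
      ⟨1, one_mem _, _, (isConj_coe_mul_coe_mul_iff hA ht).1 hgh, one_mul _⟩

theorem cosetLabel_eq_of_commute {g h : G} (hg : g ∉ Subgroup.center G)
    (hh : h ∉ Subgroup.center G) (hgh : Commute g h) : cosetLabel A t g = cosetLabel A t h := by
  obtain ⟨a, rfl⟩ | ⟨a, rfl⟩ := exists_coe_eq_or_exists_coe_mul_eq hA ht g <;>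
    obtain ⟨b, rfl⟩ | ⟨b, rfl⟩ := exists_coe_eq_or_exists_coe_mul_eq hA ht h
  · rw [cosetLabel_coe ht, cosetLabel_coe ht]
  · exact absurd ((coe_mem_center_iff hA ht).2 (commute_coe_coe_mul_iff.1 hgh)) hg
  · exact absurd ((coe_mem_center_iff hA ht).2 (commute_coe_coe_mul_iff.1 hgh.symm)) hh
  · exact cosetLabel_coe_mul_eq_iff.2
      ⟨_, commute_coe_mul_coe_mul_iff.1 hgh, 1, one_mem _, mul_one _⟩

theorem exists_isConj_commute_of_cosetLabel_eq {g h : G}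
    (hgh : cosetLabel A t g = cosetLabel A t h) : ∃ g', IsConj g g' ∧ Commute g' h := by
  obtain ⟨a, rfl⟩ | ⟨a, rfl⟩ := exists_coe_eq_or_exists_coe_mul_eq hA ht g <;>
    obtain ⟨b, rfl⟩ | ⟨b, rfl⟩ := exists_coe_eq_or_exists_coe_mul_eq hA ht h
  · exact ⟨a, .refl _, commute_coe_coe a b⟩
  · simp [cosetLabel_coe ht, cosetLabel_coe_mul] at hgh
  · simp [cosetLabel_coe ht, cosetLabel_coe_mul] at hgh
  · obtain ⟨k, hk, r, hr, hkr⟩ := cosetLabel_coe_mul_eq_iff.1 hgh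
    refine ⟨(k * b : A) * t, (isConj_coe_mul_coe_mul_iff hA ht).2 ?_,
      commute_coe_mul_coe_mul_iff.2 (by rwa [mul_div_cancel_right])⟩
    rwa [div_mul_eq_div_div_swap, ← hkr, mul_div_cancel_left]

end IndexTwo

namespace CCCVertex

/-- The vertex of the commuting conjugacy class graph given by the class of a non-central `g`. -/
def mk (g : G) (hg : g ∉ Subgroup.center G) : CCCVertex G :=
  ⟨ConjClasses.mk g, g, hg, rfl⟩

theorem exists_eq_mk (v : CCCVertex G) : ∃ g, ∃ hg : g ∉ Subgroup.center G, mk g hg = v := by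
  obtain ⟨_, g, hg, rfl⟩ := v
  exact ⟨g, hg, rfl⟩

theorem mk_eq_mk_iff {g h : G} (hg : g ∉ Subgroup.center G) (hh : h ∉ Subgroup.center G) :
    mk g hg = mk h hh ↔ IsConj g h :=
  Subtype.mk_eq_mk.trans ConjClasses.mk_eq_mk_iff_isConj

end CCCVertex

theorem cccGraph_adj_mk_mk_iff {g h : G} {hg : g ∉ Subgroup.center G}
    {hh : h ∉ Subgroup.center G} :
    (cccGraph G).Adj (.mk g hg) (.mk h hh) ↔
      CCCVertex.mk g hg ≠ .mk h hh ∧ ∃ g', IsConj g g' ∧ Commute g' h := by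
  refine and_congr_right fun _ => ⟨?_, ?_⟩
  · rintro ⟨x, y, hx, hy, hxy⟩
    obtain ⟨c, hc⟩ := isConj_iff.1 (ConjClasses.mk_eq_mk_iff_isConj.1 hy)
    refine ⟨c * x * c⁻¹, (ConjClasses.mk_eq_mk_iff_isConj.1 hx.symm).trans
      (isConj_iff.2 ⟨c, rfl⟩), ?_⟩
    rw [← hc]
    exact (Commute.conj_iff c).2 hxy
  · rintro ⟨g', hgg', hcomm⟩
    exact ⟨g', h, ConjClasses.mk_eq_mk_iff_isConj.2 hgg'.symm, rfl, hcomm⟩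

theorem notMem_center_of_isConj {g h : G} (hgh : IsConj g h) (hg : g ∉ Subgroup.center G) :
    h ∉ Subgroup.center G := fun hh => by
  obtain ⟨c, rfl⟩ := isConj_iff.1 hgh.symm
  exact hg (Subgroup.Normal.conj_mem inferInstance _ hh c)

section IndexTwo

variable (hA : A.index = 2) (ht : t ∉ A)

/-- `cosetLabel` as a function on the vertices of the commuting conjugacy class graph. -/
noncomputable def cliqueLabel (v : CCCVertex G) :
    Option (A ⧸ (commutatorHom A t).ker ⊔ (commutatorHom A t).range) :=
  Quotient.lift (cosetLabel A t) (fun _ _ h => cosetLabel_eq_of_isConj hA ht h) v.1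

theorem cliqueLabel_mk (g : G) (hg : g ∉ Subgroup.center G) :
    cliqueLabel hA ht (.mk g hg) = cosetLabel A t g :=
  rfl

theorem cccGraph_adj_iff_cliqueLabel_eq (u v : CCCVertex G) :
    (cccGraph G).Adj u v ↔ u ≠ v ∧ cliqueLabel hA ht u = cliqueLabel hA ht v := by
  obtain ⟨g, hg, rfl⟩ := u.exists_eq_mk
  obtain ⟨h, hh, rfl⟩ := v.exists_eq_mk
  rw [cccGraph_adj_mk_mk_iff, cliqueLabel_mk, cliqueLabel_mk]
  refine and_congr_right fun _ => ⟨?_, exists_isConj_commute_of_cosetLabel_eq hA ht⟩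
  rintro ⟨g', hgg', hcomm⟩
  exact (cosetLabel_eq_of_isConj hA ht hgg').trans
    (cosetLabel_eq_of_commute hA ht (notMem_center_of_isConj hgg' hg) hh hcomm)

theorem cliqueLabel_eq_none_iff {v : CCCVertex G} :
    cliqueLabel hA ht v = none ↔ ∃ a : A, ∃ ha, CCCVertex.mk (a : G) ha = v := by
  obtain ⟨g, hg, rfl⟩ := v.exists_eq_mk
  constructor
  · intro h
    obtain ⟨a, rfl⟩ | ⟨a, rfl⟩ := exists_coe_eq_or_exists_coe_mul_eq hA ht g
    · exact ⟨a, hg, rfl⟩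
    · simp [cliqueLabel_mk, cosetLabel_coe_mul] at h
  · rintro ⟨a, ha, hag⟩
    rw [← hag, cliqueLabel_mk, cosetLabel_coe ht]

theorem two_mul_ncard_cliqueLabel_none_add_card_ker [Finite G] :
    2 * (cliqueLabel hA ht ⁻¹' {none}).ncard + Nat.card (commutatorHom A t).ker = Nat.card A := by
  classical
  have := Fintype.ofFinite A
  let φ := commutatorHom A t
  have notMem_ker_iff {a : A} : a ∉ φ.ker ↔ (a : G) ∉ Subgroup.center G :=
    (coe_mem_center_iff hA ht).not.symm
  let toVertex (a : {a : A // a ∉ φ.ker}) : cliqueLabel hA ht ⁻¹' {none} :=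
    ⟨.mk (a : A) (notMem_ker_iff.1 a.2), (cliqueLabel_eq_none_iff hA ht).2 ⟨a, _, rfl⟩⟩
  have card_fiber (v) : (Finset.univ.filter fun a => toVertex a = v).card = 2 := by
    obtain ⟨v, hv⟩ := v
    obtain ⟨a, ha, rfl⟩ := (cliqueLabel_eq_none_iff hA ht).1 hv
    have isConj_self_mul : IsConj (a : G) (φ a * a : A) :=
      (isConj_coe_coe_iff hA ht).2 (.inr rfl)
    refine Finset.card_eq_two.2 ⟨⟨a, notMem_ker_iff.2 ha⟩,
      ⟨φ a * a, notMem_ker_iff.2 (notMem_center_of_isConj isConj_self_mul ha)⟩, ?_, ?_⟩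
    · simpa [φ, eq_comm] using notMem_ker_iff.2 ha
    · ext b
      have toVertex_eq_iff : toVertex b = ⟨_, hv⟩ ↔ IsConj (a : G) (b : A) := by
        rw [Subtype.ext_iff, CCCVertex.mk_eq_mk_iff, isConj_comm]
      rw [Finset.mem_filter_univ, toVertex_eq_iff, isConj_coe_coe_iff hA ht]
      simp only [Finset.mem_insert, Finset.mem_singleton, Subtype.ext_iff, φ]
  have card_noncentral :
      Fintype.card {a : A // a ∉ φ.ker} = (cliqueLabel hA ht ⁻¹' {none}).ncard * 2 := by
    rw [← Finset.card_univ, Finset.card_eq_sum_card_fiberwise (f := toVertex) (t := Finset.univ)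
      fun _ _ => Finset.mem_coe.2 (Finset.mem_univ _), Finset.sum_const_nat fun v _ => card_fiber v,
      Finset.card_univ, ← Nat.card_eq_fintype_card, Nat.card_coe_set_eq]
  have card_compl := Fintype.card_subtype_compl fun a : A => a ∈ φ.ker
  have card_le := Fintype.card_subtype_le fun a : A => a ∈ φ.ker
  simp only [← Nat.card_eq_fintype_card] at card_noncentral card_compl card_le
  change Nat.card φ.ker ≤ _ at card_le
  change _ = _ - Nat.card φ.ker at card_compl
  change 2 * _ + Nat.card φ.ker = _
  omega

theorem ncard_cliqueLabel_some (hφ : commutatorHom A t ≠ 1)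
    (q : A ⧸ (commutatorHom A t).ker ⊔ (commutatorHom A t).range) :
    (cliqueLabel hA ht ⁻¹' {some q}).ncard =
      (commutatorHom A t).range.relIndex (commutatorHom A t).ker := by
  obtain ⟨b, rfl⟩ := QuotientGroup.mk_surjective q
  let φ := commutatorHom A t
  have label_eq (k : φ.ker) :
      cosetLabel A t ((b * k : A) * t) = some (b : A ⧸ φ.ker ⊔ φ.range) := by
    rw [cosetLabel_coe_mul, QuotientGroup.mk_mul_of_mem _ (Subgroup.mem_sup_left k.2)]
  let toVertex (k : φ.ker) : cliqueLabel hA ht ⁻¹' {some ↑b} :=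
    ⟨.mk ((b * k : A) * t) (coe_mul_notMem_center hφ _), label_eq k⟩
  have toVertex_eq_iff (k l : φ.ker) :
      toVertex k = toVertex l ↔ k⁻¹ * l ∈ φ.range.subgroupOf φ.ker := by
    rw [Subtype.ext_iff, CCCVertex.mk_eq_mk_iff, isConj_comm, isConj_coe_mul_coe_mul_iff hA ht,
      mul_div_mul_left_eq_div, Subgroup.mem_subgroupOf, inv_mul_eq_div]
    rfl
  rw [← Nat.card_coe_set_eq]
  refine (Nat.card_eq_of_bijective (Quotient.lift toVertex fun k l h =>
    (toVertex_eq_iff k l).2 (QuotientGroup.leftRel_apply.1 h)) ⟨?_, ?_⟩).symm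
  · rintro ⟨k⟩ ⟨l⟩ h
    exact Quotient.sound (QuotientGroup.leftRel_apply.2 ((toVertex_eq_iff k l).1 h))
  · rintro ⟨v, hv⟩
    obtain ⟨g, hg, rfl⟩ := v.exists_eq_mk
    obtain ⟨k, hk, hconj⟩ : ∃ k ∈ φ.ker, IsConj ((b * k : A) * t : G) g := by
      obtain ⟨a, rfl⟩ | ⟨a, rfl⟩ := exists_coe_eq_or_exists_coe_mul_eq hA ht g
      · cases (cosetLabel_coe ht a).symm.trans hv
      · obtain ⟨k, hk, r, hr, hkr⟩ :=
          cosetLabel_coe_mul_eq_iff.1 (hv.trans (cosetLabel_coe_mul b).symm)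
        refine ⟨k, hk, isConj_comm.1 ((isConj_coe_mul_coe_mul_iff hA ht).2 ?_)⟩
        rwa [div_mul_eq_div_div, ← hkr, mul_div_cancel_left]
    exact ⟨Quotient.mk _ ⟨k, hk⟩, Subtype.ext <|
      (CCCVertex.mk_eq_mk_iff (coe_mul_notMem_center hφ _) hg).2 hconj⟩

include hA ht in
theorem isCliqueUnion_cccGraph [Finite G] (hφ : commutatorHom A t ≠ 1) :
    IsCliqueUnion (cccGraph G)
      (((Nat.card A - Nat.card (commutatorHom A t).ker) / 2) ::ₘ
        Multiset.replicate ((commutatorHom A t).ker ⊔ (commutatorHom A t).range).index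
          ((commutatorHom A t).range.relIndex (commutatorHom A t).ker)) := by
  let φ := commutatorHom A t
  let _ := Fintype.ofFinite (A ⧸ φ.ker ⊔ φ.range)
  refine ⟨Option (A ⧸ φ.ker ⊔ φ.range), inferInstance,
    cliqueLabel hA ht, ?_, cccGraph_adj_iff_cliqueLabel_eq hA ht, ?_⟩
  · rintro (_ | ⟨⟨a⟩⟩)
    · obtain ⟨a, ha⟩ : ∃ a, a ∉ φ.ker := by
        by_contra! h
        exact hφ (MonoidHom.ext h)
      exact ⟨_, (cliqueLabel_eq_none_iff hA ht).2
        ⟨a, mt (coe_mem_center_iff hA ht).1 ha, rfl⟩⟩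
    · exact ⟨.mk (a * t) (coe_mul_notMem_center hφ a), cosetLabel_coe_mul a⟩
  · have ncard_none : (cliqueLabel hA ht ⁻¹' {none}).ncard =
        (Nat.card A - Nat.card φ.ker) / 2 := by
      rw [← two_mul_ncard_cliqueLabel_none_add_card_ker hA ht, Nat.add_sub_cancel,
        Nat.mul_div_cancel_left _ two_pos]
    change ((none ::ₘ Finset.univ.val.map some).map _ : Multiset ℕ) = _
    rw [Multiset.map_cons, Multiset.map_map, ncard_none, Subgroup.index_eq_card,
      @Nat.card_eq_fintype_card (A ⧸ φ.ker ⊔ φ.range)]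
    exact congrArg _ ((Multiset.map_congr rfl fun q _ => ncard_cliqueLabel_some hA ht hφ q).trans
      (Multiset.map_const' _ _))

end IndexTwo

end AbelianIndexTwo

section CyclicIndexTwo

open scoped IsMulCommutative

theorem card_range_comp_self_mul_index_ker_sup_range {A : Type*} [CommGroup A] (f : A →* A) :
    Nat.card (f.comp f).range * (f.ker ⊔ f.range).index = Nat.card f.range := by
  rw [MonoidHom.range_comp, ← Subgroup.relIndex_ker, ← Subgroup.relIndex_sup_left,
    Subgroup.relIndex_mul_index le_sup_left, Subgroup.index_ker]

section PowMonoidHom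

theorem gcd_dvd_gcd_sq (a k : ℕ) : a.gcd k ∣ a.gcd (k ^ 2) :=
  Nat.gcd_dvd_gcd_of_dvd_right a (dvd_pow_self k two_ne_zero)

variable (A : Type*) [CommGroup A] [IsCyclic A] [Finite A] (k : ℕ)

theorem index_ker_sup_range_powMonoidHom :
    ((powMonoidHom k : A →* A).ker ⊔ (powMonoidHom k : A →* A).range).index =
      (Nat.card A).gcd (k ^ 2) / (Nat.card A).gcd k := by
  have comp_self : (powMonoidHom k : A →* A).comp (powMonoidHom k) = powMonoidHom (k ^ 2) := by
    ext a
    simp [← pow_mul, sq]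
  have card_mul_index := card_range_comp_self_mul_index_ker_sup_range (powMonoidHom k : A →* A)
  rw [comp_self, IsCyclic.card_powMonoidHom_range, IsCyclic.card_powMonoidHom_range]
    at card_mul_index
  have quotient_pos : 0 < Nat.card A / (Nat.card A).gcd (k ^ 2) :=
    Nat.div_pos (Nat.gcd_le_left _ Nat.card_pos) (Nat.gcd_pos_of_pos_left _ Nat.card_pos)
  refine Nat.eq_of_mul_eq_mul_left quotient_pos (card_mul_index.trans ?_)
  rw [Nat.div_mul_div_comm (Nat.gcd_dvd_left _ _) (gcd_dvd_gcd_sq _ _), mul_comm,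
    Nat.mul_div_mul_left _ _ (Nat.gcd_pos_of_pos_left _ Nat.card_pos)]

theorem relIndex_range_ker_powMonoidHom :
    (powMonoidHom k : A →* A).range.relIndex (powMonoidHom k : A →* A).ker =
      (Nat.card A).gcd k ^ 2 / (Nat.card A).gcd (k ^ 2) := by
  have mul_index := Subgroup.relIndex_mul_index
    (le_sup_right : (powMonoidHom k : A →* A).range ≤ (powMonoidHom k : A →* A).ker ⊔ _)
  rw [Subgroup.relIndex_sup_right, IsCyclic.index_powMonoidHom_range,
    index_ker_sup_range_powMonoidHom] at mul_index
  have gcd_pos : 0 < (Nat.card A).gcd k := Nat.gcd_pos_of_pos_left k Nat.card_pos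
  obtain ⟨e, he⟩ := gcd_dvd_gcd_sq (Nat.card A) k
  rw [he, Nat.mul_div_cancel_left e gcd_pos] at mul_index
  have e_pos : 0 < e := Nat.pos_of_mul_pos_left (mul_index.symm ▸ gcd_pos)
  rw [he, sq, Nat.mul_div_mul_left _ _ gcd_pos, ← mul_index, Nat.mul_div_cancel _ e_pos]

end PowMonoidHom

theorem isCliqueUnion_cccGraph_of_isCyclic {G : Type*} [Group G] [Finite G] {A : Subgroup G}
    [IsCyclic A] {t : G} {k : ℕ} (hA : A.index = 2) (ht : t ∉ A)
    (conj_eq : ∀ a ∈ A, t * a * t⁻¹ = a ^ (k + 1)) (hk : ¬Nat.card A ∣ k) :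
    IsCliqueUnion (cccGraph G)
      (((Nat.card A - (Nat.card A).gcd k) / 2) ::ₘ
        Multiset.replicate ((Nat.card A).gcd (k ^ 2) / (Nat.card A).gcd k)
          ((Nat.card A).gcd k ^ 2 / (Nat.card A).gcd (k ^ 2))) := by
  have := Subgroup.normal_of_index_eq_two hA
  have commutatorHom_eq : commutatorHom A t = powMonoidHom k := by
    ext a
    have mul_eq := mul_coe_eq_commutatorHom_mul (t := t) a
    rw [← mul_inv_eq_iff_eq_mul, conj_eq a a.2, pow_succ, Subgroup.coe_mul, mul_left_inj] at mul_eq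
    exact mul_eq.symm
  have commutatorHom_ne_one : commutatorHom A t ≠ 1 := by
    rw [commutatorHom_eq]
    intro h
    have card_ker := IsCyclic.card_powMonoidHom_ker A k
    rw [h, MonoidHom.ker_one, Subgroup.card_top] at card_ker
    exact hk (Nat.gcd_eq_left_iff_dvd.1 card_ker.symm)
  simpa only [commutatorHom_eq, IsCyclic.card_powMonoidHom_ker, index_ker_sup_range_powMonoidHom,
    relIndex_range_ker_powMonoidHom] using isCliqueUnion_cccGraph hA ht commutatorHom_ne_one

end CyclicIndexTwo

namespace SD

/-- The generator `x` of order `4 * n`. -/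
def x (n : ℕ) : SD n := PresentedGroup.of 0

/-- The generator `y` of order `2`. -/
def y (n : ℕ) : SD n := PresentedGroup.of 1

variable {n : ℕ}

theorem x_pow : x n ^ (4 * n) = 1 :=
  PresentedGroup.one_of_mem (rels := semidihedralRels n) (by simp [semidihedralRels])

theorem y_mul_y : y n * y n = 1 :=
  (sq _).symm.trans
    (PresentedGroup.one_of_mem (rels := semidihedralRels n) (by simp [semidihedralRels]))

theorem y_inv : (y n)⁻¹ = y n :=
  inv_eq_of_mul_eq_one_left y_mul_y

theorem y_mul_x_mul_y : y n * x n * y n = x n ^ (2 * n - 1) :=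
  mul_inv_eq_one.1
    (PresentedGroup.one_of_mem (rels := semidihedralRels n) (by simp [semidihedralRels]))

theorem y_conj_of_mem_zpowers_x {a : SD n} (ha : a ∈ Subgroup.zpowers (x n)) :
    y n * a * (y n)⁻¹ = a ^ (2 * n - 1) := by
  obtain ⟨i, rfl⟩ := ha
  rw [← conj_zpow, y_inv, y_mul_x_mul_y, ← zpow_natCast, ← zpow_natCast, zpow_comm]

/-- Multiplication by `2 * n - 1` on `ZMod (4 * n)`. -/
def mulTwist (n : ℕ) [NeZero n] : Equiv.Perm (ZMod (4 * n)) :=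
  Function.Involutive.toPerm (fun i => (2 * n - 1) * i) fun i => by
    have four_mul : (4 * n : ZMod (4 * n)) = 0 := mod_cast ZMod.natCast_self (4 * n)
    linear_combination (n - 1) * i * four_mul

theorem mulTwist_apply [NeZero n] (i : ZMod (4 * n)) : mulTwist n i = (2 * n - 1) * i :=
  rfl

/-- The permutation action of `SD n` on `ZMod (4 * n)` where `x` acts by `i ↦ 1 + i` and `y` by
`i ↦ (2 * n - 1) * i`. It is faithful on the powers of `x`. -/
def affineAction (n : ℕ) [NeZero n] : SD n →* Equiv.Perm (ZMod (4 * n)) :=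
  PresentedGroup.toGroup (f := ![Equiv.addLeft 1, mulTwist n]) <| by
    have four_mul : (4 * n : ZMod (4 * n)) = 0 := mod_cast ZMod.natCast_self (4 * n)
    have two_mul_sub_one : ((2 * n - 1 : ℕ) : ZMod (4 * n)) = 2 * n - 1 := by
      rw [Nat.cast_sub (by have := NeZero.one_le (n := n); omega)]
      push_cast
      rfl
    rintro r (rfl | rfl | rfl)
    · ext1 i
      simp
    · ext1 i
      simp only [sq, map_mul, FreeGroup.lift_apply_of, Matrix.cons_val_one,
        Matrix.cons_val_fin_one, Equiv.Perm.mul_apply, mulTwist_apply, Equiv.Perm.one_apply]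
      linear_combination (n - 1) * i * four_mul
    · rw [map_mul, map_inv, mul_inv_eq_one]
      ext1 i
      simp only [map_mul, map_pow, FreeGroup.lift_apply_of, Matrix.cons_val_zero,
        Matrix.cons_val_one, Matrix.cons_val_fin_one, Equiv.Perm.mul_apply, mulTwist_apply,
        Equiv.nsmul_addLeft, Equiv.coe_addLeft, nsmul_eq_mul, two_mul_sub_one, mul_one]
      linear_combination (n - 1) * i * four_mul

theorem orderOf_x [NeZero n] : orderOf (x n) = 4 * n := by
  refine Nat.dvd_antisymm (orderOf_dvd_of_pow_eq_one x_pow) ?_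
  have affineAction_x : affineAction n (x n) = Equiv.addLeft 1 :=
    PresentedGroup.toGroup.of _
  have apply_zero := DFunLike.congr_fun (congrArg (affineAction n) (pow_orderOf_eq_one (x n))) 0
  rw [map_pow, affineAction_x] at apply_zero
  rw [← ZMod.natCast_eq_zero_iff]
  simpa using apply_zero

theorem mem_zpowers_x_or_mul_y_mem_zpowers_x (g : SD n) :
    g ∈ Subgroup.zpowers (x n) ∨ g * y n ∈ Subgroup.zpowers (x n) := by
  have conj_mem {a : SD n} (ha : a ∈ Subgroup.zpowers (x n)) :
      y n * a * y n ∈ Subgroup.zpowers (x n) := by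
    have y_conj := y_conj_of_mem_zpowers_x ha
    rw [y_inv] at y_conj
    exact y_conj ▸ pow_mem ha _
  have x_mem : x n ∈ Subgroup.zpowers (x n) := Subgroup.mem_zpowers _
  have y_mul {g : SD n} (hg : g ∈ Subgroup.zpowers (x n) ∨ g * y n ∈ Subgroup.zpowers (x n)) :
      y n * g ∈ Subgroup.zpowers (x n) ∨ y n * g * y n ∈ Subgroup.zpowers (x n) := by
    refine hg.symm.imp (fun h => ?_) conj_mem
    have := conj_mem h
    rwa [← mul_assoc, mul_assoc, y_mul_y, mul_one] at this
  have hg : g ∈ Subgroup.closure (Set.range PresentedGroup.of) :=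
    PresentedGroup.closure_range_of _ ▸ Subgroup.mem_top g
  induction hg using Subgroup.closure_induction_left with
  | one => exact .inl (one_mem _)
  | mul_left a ha b _ hb =>
    obtain ⟨k, rfl⟩ := ha
    fin_cases k
    · exact hb.imp (mul_mem x_mem) fun h => mul_assoc (x n) b _ ▸ mul_mem x_mem h
    · exact y_mul hb
  | inv_mul_cancel a ha b _ hb =>
    obtain ⟨k, rfl⟩ := ha
    fin_cases k
    · exact hb.imp (mul_mem (inv_mem x_mem)) fun h =>
        mul_assoc (x n)⁻¹ b _ ▸ mul_mem (inv_mem x_mem) h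
    · exact (y_inv (n := n)).symm ▸ y_mul hb

theorem y_notMem_zpowers_x (hn : 2 ≤ n) : y n ∉ Subgroup.zpowers (x n) := by
  intro h
  have : NeZero n := ⟨by omega⟩
  have x_pow_eq : x n ^ (2 * n - 1) = x n ^ 1 := by
    rw [← y_conj_of_mem_zpowers_x (Subgroup.mem_zpowers _), pow_one, mul_inv_eq_iff_eq_mul]
    exact setLike_mul_comm h (Subgroup.mem_zpowers _)
  rw [pow_inj_mod, orderOf_x, Nat.mod_eq_of_lt (by omega), Nat.mod_eq_of_lt (by omega)] at x_pow_eq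
  omega

theorem index_zpowers_x (hn : 2 ≤ n) : (Subgroup.zpowers (x n)).index = 2 :=
  Subgroup.index_eq_two_iff_exists_notMem_and.2
    ⟨y n, y_notMem_zpowers_x hn, fun g => (mem_zpowers_x_or_mul_y_mem_zpowers_x g).symm⟩

theorem card_zpowers_x [NeZero n] : Nat.card (Subgroup.zpowers (x n)) = 4 * n :=
  (Nat.card_zpowers _).trans orderOf_x

theorem gcd_four_mul_two_mul_sub_two (hn : 1 ≤ n) :
    (4 * n).gcd (2 * n - 2) = 2 * Nat.gcd 2 (n - 1) := by
  obtain ⟨m, rfl⟩ := Nat.exists_eq_add_of_le' hn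
  rw [show 4 * (m + 1) = 2 * (2 + 2 * m) by ring, show 2 * (m + 1) - 2 = 2 * m by omega,
    Nat.gcd_mul_left, Nat.gcd_add_mul_right_left, Nat.add_sub_cancel]

theorem gcd_four_mul_two_mul_sub_two_sq (hn : 1 ≤ n) : (4 * n).gcd ((2 * n - 2) ^ 2) = 4 := by
  obtain ⟨m, rfl⟩ := Nat.exists_eq_add_of_le' hn
  have coprime : (m + 1).Coprime (m ^ 2) := .pow_right 2 (by simp)
  rw [mul_add_one 2, Nat.add_sub_cancel, mul_pow, show 2 ^ 2 = 4 from rfl,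
    Nat.gcd_mul_left, coprime.gcd_eq_one]

theorem isCliqueUnion_cccGraph (hn : 2 ≤ n) :
    IsCliqueUnion (cccGraph (SD n))
      (((4 * n - (4 * n).gcd (2 * n - 2)) / 2) ::ₘ
        Multiset.replicate (4 / (4 * n).gcd (2 * n - 2)) ((4 * n).gcd (2 * n - 2) ^ 2 / 4)) := by
  have : NeZero n := ⟨by omega⟩
  have conj_eq (a) (ha : a ∈ Subgroup.zpowers (x n)) :
      y n * a * (y n)⁻¹ = a ^ (2 * n - 2 + 1) := by
    rw [y_conj_of_mem_zpowers_x ha]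
    congr 1
    omega
  have not_dvd : ¬4 * n ∣ 2 * n - 2 := Nat.not_dvd_of_pos_of_lt (by omega) (by omega)
  simpa only [card_zpowers_x, gcd_four_mul_two_mul_sub_two_sq (n := n) (by omega)] using
    isCliqueUnion_cccGraph_of_isCyclic (index_zpowers_x hn) (y_notMem_zpowers_x hn) conj_eq
      (by rwa [card_zpowers_x])

theorem isCliqueUnion_cccGraph_of_even (hn : 2 ≤ n) (he : Even n) :
    IsCliqueUnion (cccGraph (SD n)) {2 * n - 1, 1, 1} := by
  have gcd_eq : Nat.gcd 2 (n - 1) = 1 :=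
    (Nat.coprime_two_left).2 (Nat.Even.sub_odd (by omega) he odd_one)
  have h := isCliqueUnion_cccGraph hn
  rw [gcd_four_mul_two_mul_sub_two (by omega), gcd_eq] at h
  rwa [show (4 * n - 2 * 1) / 2 = 2 * n - 1 by omega] at h

theorem isCliqueUnion_cccGraph_of_odd (hn : 2 ≤ n) (ho : Odd n) :
    IsCliqueUnion (cccGraph (SD n)) {2 * n - 2, 4} := by
  have gcd_eq : Nat.gcd 2 (n - 1) = 2 :=
    Nat.gcd_eq_left (Nat.Odd.sub_odd ho odd_one).two_dvd
  have h := isCliqueUnion_cccGraph hn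
  rw [gcd_four_mul_two_mul_sub_two (by omega), gcd_eq] at h
  rwa [show (4 * n - 2 * 2) / 2 = 2 * n - 2 by omega] at h

end SD

section SemidihedralSpectra

variable {n : ℕ}

theorem cast_two_mul_sub {k : ℕ} (hk : k ≤ 2 * n) : ((2 * n - k : ℕ) : ℝ) = 2 * n - k := by
  rw [Nat.cast_sub hk, Nat.cast_mul, Nat.cast_ofNat]

theorem cnlSpec_cccGraph_SD_of_even (hn : 2 ≤ n) (he : Even n) :
    cnlSpec (cccGraph (SD n)) =
      Multiset.replicate 3 (0 : ℝ) +
      Multiset.replicate (2 * n - 2) ((2 * (n : ℝ) - 1) * (2 * (n : ℝ) - 3)) := by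
  have main_eigenvalue : ((2 * n - 1 : ℕ) : ℝ) * ((2 * n - 1 : ℕ) - 2) =
      (2 * n - 1) * (2 * n - 3) := by
    rw [cast_two_mul_sub (by omega)]
    push_cast
    ring
  rw [(SD.isCliqueUnion_cccGraph_of_even hn he).cnlSpec_eq]
  simp only [Multiset.insert_eq_cons, Multiset.cons_bind, Multiset.singleton_bind,
    main_eigenvalue, Nat.sub_self, Multiset.replicate_zero, zero_add, Nat.sub_sub]
  rw [show Multiset.replicate 3 (0 : ℝ) = {0} + ({0} + {0}) from rfl]
  abel

theorem cnslSpec_cccGraph_SD_of_even (hn : 2 ≤ n) (he : Even n) :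
    cnslSpec (cccGraph (SD n)) =
      Multiset.replicate 2 (0 : ℝ) +
      Multiset.replicate 1 (2 * (2 * (n : ℝ) - 2) * (2 * (n : ℝ) - 3)) +
      Multiset.replicate (2 * n - 2) ((2 * (n : ℝ) - 3) ^ 2) := by
  have cast_sub_two : ((2 * n - 1 : ℕ) : ℝ) - 2 = 2 * n - 3 := by
    rw [cast_two_mul_sub (by omega)]
    push_cast
    ring
  have cast_sub_one : ((2 * n - 1 : ℕ) : ℝ) - 1 = 2 * n - 2 := by
    rw [cast_two_mul_sub (by omega)]
    push_cast
    ring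
  rw [(SD.isCliqueUnion_cccGraph_of_even hn he).cnslSpec_eq]
  simp only [Multiset.insert_eq_cons, Multiset.cons_bind, Multiset.singleton_bind,
    cast_sub_two, cast_sub_one, Nat.sub_self, Multiset.replicate_zero, zero_add, Nat.sub_sub,
    Nat.cast_one, sub_self, mul_zero, zero_mul, Multiset.replicate_one]
  rw [show Multiset.replicate 2 (0 : ℝ) = {0} + {0} from rfl]
  abel

theorem cnDelta_cccGraph_SD_of_even (hn : 2 ≤ n) (he : Even n) :
    cnDelta (cccGraph (SD n)) =
      (2 * (n : ℝ) - 1) * (2 * n - 2) * (2 * n - 3) / (2 * n + 1) := by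
  rw [(SD.isCliqueUnion_cccGraph_of_even hn he).cnDelta_eq]
  simp only [Multiset.insert_eq_cons, Multiset.map_cons, Multiset.map_singleton,
    Multiset.sum_cons, Multiset.sum_singleton, Nat.cast_add,
    cast_two_mul_sub (n := n) (k := 1) (by omega)]
  congr 1 <;> push_cast <;> ring

theorem cnlSpec_cccGraph_SD_of_odd (hn : 2 ≤ n) (ho : Odd n) :
    cnlSpec (cccGraph (SD n)) =
      Multiset.replicate 2 (0 : ℝ) + Multiset.replicate 3 (8 : ℝ) +
      Multiset.replicate (2 * n - 3) ((2 * (n : ℝ) - 2) * (2 * (n : ℝ) - 4)) := by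
  have main_eigenvalue : ((2 * n - 2 : ℕ) : ℝ) * ((2 * n - 2 : ℕ) - 2) =
      (2 * n - 2) * (2 * n - 4) := by
    rw [cast_two_mul_sub (by omega)]
    push_cast
    ring
  have four_eigenvalue : ((4 : ℕ) : ℝ) * ((4 : ℕ) - 2) = 8 := by norm_num
  rw [(SD.isCliqueUnion_cccGraph_of_odd hn ho).cnlSpec_eq]
  simp only [Multiset.insert_eq_cons, Multiset.cons_bind, Multiset.singleton_bind,
    main_eigenvalue, four_eigenvalue, Nat.sub_sub]
  rw [show Multiset.replicate 2 (0 : ℝ) = {0} + {0} from rfl]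
  abel

theorem cnslSpec_cccGraph_SD_of_odd (hn : 2 ≤ n) (ho : Odd n) :
    cnslSpec (cccGraph (SD n)) =
      Multiset.replicate 1 (2 * (2 * (n : ℝ) - 3) * (2 * (n : ℝ) - 4)) +
      Multiset.replicate (2 * n - 3) ((2 * (n : ℝ) - 4) ^ 2) +
      Multiset.replicate 1 (12 : ℝ) + Multiset.replicate 3 (4 : ℝ) := by
  have cast_sub_two : ((2 * n - 2 : ℕ) : ℝ) - 2 = 2 * n - 4 := by
    rw [cast_two_mul_sub (by omega)]
    push_cast
    ring
  have cast_sub_one : ((2 * n - 2 : ℕ) : ℝ) - 1 = 2 * n - 3 := by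
    rw [cast_two_mul_sub (by omega)]
    push_cast
    ring
  have four_eigenvalue : (((4 : ℕ) : ℝ) - 2) ^ 2 = 4 := by norm_num
  have four_top_eigenvalue : 2 * (((4 : ℕ) : ℝ) - 1) * ((4 : ℕ) - 2) = 12 := by norm_num
  rw [(SD.isCliqueUnion_cccGraph_of_odd hn ho).cnslSpec_eq]
  simp only [Multiset.insert_eq_cons, Multiset.cons_bind, Multiset.singleton_bind,
    cast_sub_two, cast_sub_one, four_eigenvalue, four_top_eigenvalue, Nat.sub_sub,
    Multiset.replicate_one]
  abel

theorem cnDelta_cccGraph_SD_of_odd (hn : 2 ≤ n) (ho : Odd n) :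
    cnDelta (cccGraph (SD n)) =
      (2 * ((n : ℝ) - 1) * (n - 2) * (2 * n - 3) + 12) / (n + 1) := by
  rw [(SD.isCliqueUnion_cccGraph_of_odd hn ho).cnDelta_eq,
    ← mul_div_mul_left (2 * ((n : ℝ) - 1) * (n - 2) * (2 * n - 3) + 12) _ (two_ne_zero' ℝ)]
  simp only [Multiset.insert_eq_cons, Multiset.map_cons, Multiset.map_singleton,
    Multiset.sum_cons, Multiset.sum_singleton, Nat.cast_add,
    cast_two_mul_sub (n := n) (k := 2) (by omega)]
  congr 1 <;> push_cast <;> ring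

theorem cnDelta_cccGraph_SD_nonneg_of_even (hn : 2 ≤ n) (he : Even n) :
    0 ≤ cnDelta (cccGraph (SD n)) := by
  have two_le : (2 : ℝ) ≤ n := mod_cast hn
  rw [cnDelta_cccGraph_SD_of_even hn he]
  exact div_nonneg (mul_nonneg (mul_nonneg (by linarith) (by linarith)) (by linarith))
    (by linarith)

theorem cnDelta_cccGraph_SD_le_of_even (hn : 2 ≤ n) (he : Even n) :
    cnDelta (cccGraph (SD n)) ≤ (2 * n - 1) * (2 * n - 3) := by
  have two_le : (2 : ℝ) ≤ n := mod_cast hn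
  have factors_nonneg : 0 ≤ (2 * (n : ℝ) - 1) * (2 * n - 3) :=
    mul_nonneg (by linarith) (by linarith)
  rw [cnDelta_cccGraph_SD_of_even hn he, div_le_iff₀ (by linarith), mul_right_comm]
  exact mul_le_mul_of_nonneg_left (by linarith) factors_nonneg

theorem cnDelta_cccGraph_SD_le_sq_of_even (hn : 4 ≤ n) (he : Even n) :
    cnDelta (cccGraph (SD n)) ≤ (2 * n - 3) ^ 2 := by
  have four_le : (4 : ℝ) ≤ n := mod_cast hn
  rw [cnDelta_cccGraph_SD_of_even (by omega) he, div_le_iff₀ (by linarith)]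
  calc (2 * (n : ℝ) - 1) * (2 * n - 2) * (2 * n - 3)
      ≤ (2 * n - 3) * (2 * n + 1) * (2 * n - 3) :=
        mul_le_mul_of_nonneg_right (by linarith) (by linarith)
    _ = (2 * n - 3) ^ 2 * (2 * n + 1) := by ring

theorem cnlEnergy_cccGraph_SD_of_even (hn : 2 ≤ n) (he : Even n) :
    cnlEnergy (cccGraph (SD n)) =
      12 * ((n : ℝ) - 1) * (4 * ((n : ℝ) - 2) * (n : ℝ) + 3) / (2 * (n : ℝ) + 1) := by
  have Δ_nonneg := cnDelta_cccGraph_SD_nonneg_of_even hn he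
  have Δ_le := cnDelta_cccGraph_SD_le_of_even hn he
  rw [cnlEnergy, cnlSpec_cccGraph_SD_of_even hn he]
  simp only [Multiset.map_add, Multiset.map_replicate, Multiset.sum_add, Multiset.sum_replicate,
    nsmul_eq_mul, cast_two_mul_sub (n := n) (k := 2) (by omega)]
  rw [abs_of_nonpos (by linarith), abs_of_nonneg (sub_nonneg.2 Δ_le),
    cnDelta_cccGraph_SD_of_even hn he]
  field_simp
  push_cast
  ring

theorem cnslEnergy_cccGraph_SD_two : cnslEnergy (cccGraph (SD 2)) = 28 / 5 := by
  rw [cnslEnergy, cnDelta_cccGraph_SD_of_even le_rfl even_two,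
    cnslSpec_cccGraph_SD_of_even le_rfl even_two]
  simp only [Multiset.map_add, Multiset.map_replicate, Multiset.sum_add, Multiset.sum_replicate,
    nsmul_eq_mul]
  norm_num [abs_of_pos, abs_of_neg]

theorem cnslEnergy_cccGraph_SD_of_even (hn : 4 ≤ n) (he : Even n) :
    cnslEnergy (cccGraph (SD n)) =
      8 * ((n : ℝ) - 1) * (2 * (n : ℝ) - 3) * (2 * (n : ℝ) - 1) / (2 * (n : ℝ) + 1) := by
  have four_le : (4 : ℝ) ≤ n := mod_cast hn
  have Δ_nonneg := cnDelta_cccGraph_SD_nonneg_of_even (by omega) he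
  have Δ_le_sq := cnDelta_cccGraph_SD_le_sq_of_even hn he
  have Δ_le_top : cnDelta (cccGraph (SD n)) ≤ 2 * (2 * n - 2) * (2 * n - 3) :=
    Δ_le_sq.trans (by nlinarith)
  rw [cnslEnergy, cnslSpec_cccGraph_SD_of_even (by omega) he]
  simp only [Multiset.map_add, Multiset.map_replicate, Multiset.sum_add, Multiset.sum_replicate,
    nsmul_eq_mul, cast_two_mul_sub (n := n) (k := 2) (by omega)]
  rw [abs_of_nonpos (by linarith), abs_of_nonneg (sub_nonneg.2 Δ_le_top),
    abs_of_nonneg (sub_nonneg.2 Δ_le_sq), cnDelta_cccGraph_SD_of_even (by omega) he]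
  field_simp
  push_cast
  ring

theorem cnlEnergy_cccGraph_SD_three : cnlEnergy (cccGraph (SD 3)) = 24 := by
  have odd_three : Odd 3 := by decide
  rw [cnlEnergy, cnDelta_cccGraph_SD_of_odd (by norm_num) odd_three,
    cnlSpec_cccGraph_SD_of_odd (by norm_num) odd_three]
  simp only [Multiset.map_add, Multiset.map_replicate, Multiset.sum_add, Multiset.sum_replicate,
    nsmul_eq_mul]
  norm_num

theorem cnslEnergy_cccGraph_SD_three : cnslEnergy (cccGraph (SD 3)) = 24 := by
  have odd_three : Odd 3 := by decide
  rw [cnslEnergy, cnDelta_cccGraph_SD_of_odd (by norm_num) odd_three,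
    cnslSpec_cccGraph_SD_of_odd (by norm_num) odd_three]
  simp only [Multiset.map_add, Multiset.map_replicate, Multiset.sum_add, Multiset.sum_replicate,
    nsmul_eq_mul]
  norm_num

theorem twelve_le_cnDelta_cccGraph_SD_of_odd (hn : 5 ≤ n) (ho : Odd n) :
    12 ≤ cnDelta (cccGraph (SD n)) := by
  have five_le : (5 : ℝ) ≤ n := mod_cast hn
  have product_le : 3 * 7 ≤ ((n : ℝ) - 2) * (2 * n - 3) :=
    mul_le_mul (by linarith) (by linarith) (by norm_num) (by linarith)
  have scaled_product_le :=
    mul_le_mul_of_nonneg_left product_le (show 0 ≤ 2 * ((n : ℝ) - 1) by linarith)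
  rw [cnDelta_cccGraph_SD_of_odd (by omega) ho, le_div_iff₀ (by linarith)]
  linarith

theorem cnDelta_cccGraph_SD_le_sq_of_odd (hn : 5 ≤ n) (ho : Odd n) :
    cnDelta (cccGraph (SD n)) ≤ (2 * n - 4) ^ 2 := by
  have five_le : (5 : ℝ) ≤ n := mod_cast hn
  rw [cnDelta_cccGraph_SD_of_odd (by omega) ho, div_le_iff₀ (by linarith)]
  nlinarith [mul_nonneg (sub_nonneg.2 five_le) (sub_nonneg.2 five_le)]

theorem cnlEnergy_cccGraph_SD_of_odd (hn : 5 ≤ n) (ho : Odd n) :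
    cnlEnergy (cccGraph (SD n)) =
      4 * (2 * (n : ℝ) - 3) * (5 * ((n : ℝ) - 3) * (n : ℝ) + 4) / ((n : ℝ) + 1) := by
  have five_le : (5 : ℝ) ≤ n := mod_cast hn
  have twelve_le_Δ := twelve_le_cnDelta_cccGraph_SD_of_odd hn ho
  have Δ_le : cnDelta (cccGraph (SD n)) ≤ (2 * n - 2) * (2 * n - 4) :=
    (cnDelta_cccGraph_SD_le_sq_of_odd hn ho).trans (by nlinarith)
  rw [cnlEnergy, cnlSpec_cccGraph_SD_of_odd (by omega) ho]
  simp only [Multiset.map_add, Multiset.map_replicate, Multiset.sum_add, Multiset.sum_replicate,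
    nsmul_eq_mul, cast_two_mul_sub (n := n) (k := 3) (by omega)]
  rw [abs_of_nonpos (by linarith), abs_of_nonpos (by linarith),
    abs_of_nonneg (sub_nonneg.2 Δ_le), cnDelta_cccGraph_SD_of_odd (by omega) ho]
  field_simp
  push_cast
  ring

theorem cnslEnergy_cccGraph_SD_of_odd (hn : 5 ≤ n) (ho : Odd n) :
    cnslEnergy (cccGraph (SD n)) =
      16 * ((n : ℝ) - 3) * ((n : ℝ) - 1) * (2 * (n : ℝ) - 1) / ((n : ℝ) + 1) := by
  have five_le : (5 : ℝ) ≤ n := mod_cast hn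
  have twelve_le_Δ := twelve_le_cnDelta_cccGraph_SD_of_odd hn ho
  have Δ_le_sq := cnDelta_cccGraph_SD_le_sq_of_odd hn ho
  have Δ_le_top : cnDelta (cccGraph (SD n)) ≤ 2 * (2 * n - 3) * (2 * n - 4) :=
    Δ_le_sq.trans (by nlinarith)
  rw [cnslEnergy, cnslSpec_cccGraph_SD_of_odd (by omega) ho]
  simp only [Multiset.map_add, Multiset.map_replicate, Multiset.sum_add, Multiset.sum_replicate,
    nsmul_eq_mul, cast_two_mul_sub (n := n) (k := 3) (by omega)]
  rw [abs_of_nonneg (sub_nonneg.2 Δ_le_top), abs_of_nonneg (sub_nonneg.2 Δ_le_sq),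
    abs_of_nonpos (by linarith), abs_of_nonpos (by linarith),
    cnDelta_cccGraph_SD_of_odd (by omega) ho]
  field_simp
  push_cast
  ring

end SemidihedralSpectra

theorem mainTheorem12 (n : ℕ) (hn : 2 ≤ n) :
    (Even n →
      (cnlSpec (cccGraph (SD n)) =
          Multiset.replicate 3 (0 : ℝ) +
          Multiset.replicate (2 * n - 2) ((2 * (n : ℝ) - 1) * (2 * (n : ℝ) - 3)) ∧
        cnlEnergy (cccGraph (SD n)) =
          12 * ((n : ℝ) - 1) * (4 * ((n : ℝ) - 2) * (n : ℝ) + 3) / (2 * (n : ℝ) + 1)) ∧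
      (cnslSpec (cccGraph (SD n)) =
          Multiset.replicate 2 (0 : ℝ) +
          Multiset.replicate 1 (2 * (2 * (n : ℝ) - 2) * (2 * (n : ℝ) - 3)) +
          Multiset.replicate (2 * n - 2) ((2 * (n : ℝ) - 3) ^ 2) ∧
        (n = 2 → cnslEnergy (cccGraph (SD n)) = 28 / 5) ∧
        (4 ≤ n → cnslEnergy (cccGraph (SD n)) =
          8 * ((n : ℝ) - 1) * (2 * (n : ℝ) - 3) * (2 * (n : ℝ) - 1) / (2 * (n : ℝ) + 1)))) ∧
    (Odd n →
      (cnlSpec (cccGraph (SD n)) =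
          Multiset.replicate 2 (0 : ℝ) +
          Multiset.replicate 3 (8 : ℝ) +
          Multiset.replicate (2 * n - 3) ((2 * (n : ℝ) - 2) * (2 * (n : ℝ) - 4)) ∧
        (n = 3 → cnlEnergy (cccGraph (SD n)) = 24) ∧
        (5 ≤ n → cnlEnergy (cccGraph (SD n)) =
          4 * (2 * (n : ℝ) - 3) * (5 * ((n : ℝ) - 3) * (n : ℝ) + 4) / ((n : ℝ) + 1))) ∧
      (cnslSpec (cccGraph (SD n)) =
          Multiset.replicate 1 (2 * (2 * (n : ℝ) - 3) * (2 * (n : ℝ) - 4)) +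
          Multiset.replicate (2 * n - 3) ((2 * (n : ℝ) - 4) ^ 2) +
          Multiset.replicate 1 (12 : ℝ) +
          Multiset.replicate 3 (4 : ℝ) ∧
        (n = 3 → cnslEnergy (cccGraph (SD n)) = 24) ∧
        (5 ≤ n → cnslEnergy (cccGraph (SD n)) =
          16 * ((n : ℝ) - 3) * ((n : ℝ) - 1) * (2 * (n : ℝ) - 1) / ((n : ℝ) + 1)))) := by
  refine ⟨fun he => ⟨⟨cnlSpec_cccGraph_SD_of_even hn he, cnlEnergy_cccGraph_SD_of_even hn he⟩,
    cnslSpec_cccGraph_SD_of_even hn he, ?_, fun h => cnslEnergy_cccGraph_SD_of_even h he⟩,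
    fun ho => ⟨⟨cnlSpec_cccGraph_SD_of_odd hn ho, ?_, fun h => cnlEnergy_cccGraph_SD_of_odd h ho⟩,
      cnslSpec_cccGraph_SD_of_odd hn ho, ?_, fun h => cnslEnergy_cccGraph_SD_of_odd h ho⟩⟩
  · rintro rfl
    exact cnslEnergy_cccGraph_SD_two
  · rintro rfl
    exact cnlEnergy_cccGraph_SD_three
  · rintro rfl
    exact cnslEnergy_cccGraph_SD_three
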